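/- For an integer $n\ge 0$ let $D_n(x)=\sum_{k=0}^n\cos kx$. A $\{0,1\}$-cosine polynomial is a function $g(x)=\sum_{a\in A}\cos(ax)$ with $A\subseteq\{0,1,2,\dots\}$ finite; its degree is $\max A$ (and $0$ if $A=\emptyset$). Put $$\mathcal{E}(g)=\Big\{x\in(0,\pi] : \big|g(x)-\tfrac12\big|<\frac{1}{2\sin(x/2)}\Big\},$$ let $|\mathcal{E}(g)|$ denote its Lebesgue measure, and let $Z(f)$ denote the number of zeros of $f$ in $[0,2\pi]$. There is an absolute constant $c>0$, and for every $\alpha\in(0,1)$ a constant $C_\alpha>0$ depending only on $\alpha$, such that the following holds. Let $n\ge 0$ be an integer, let $g$ be a $\{0,1\}$-cosine polynomial of degree $m\le n^{1-\alpha}$, and suppose that $f=D_n-g$ is not identically zero. Then $f$ has finitely many zeros in $[0,2\pi]$ and $$\frac{n}{2\pi}\,|\mathcal{E}(g)|-cm\;\le\; Z(f)\;\le\; C_\alpha\big(n|\mathcal{E}(g)|+m\big)+c\,n^{0.6}.$$ Both inequalities hold whether zeros are counted without or with multiplicity. -/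

import Mathlib

open MeasureTheory

namespace CosineZeros

noncomputable section

/-- The `{0,1}`-cosine polynomial `∑_{a ∈ A} cos (a x)` with set of frequencies `A`
(the frequency `0`, i.e. the constant term `1`, is allowed). -/
def cosPoly (A : Finset ℕ) (x : ℝ) : ℝ := ∑ a ∈ A, Real.cos ((a : ℝ) * x)

/-- The degree of `cosPoly A`: the largest frequency that occurs
(`0` for the zero polynomial). -/
def cosDegree (A : Finset ℕ) : ℕ := A.sup id

/-- `D_n(x) = ∑_{k=0}^n cos (k x)`. -/
def D (n : ℕ) (x : ℝ) : ℝ := ∑ k ∈ Finset.range (n + 1), Real.cos ((k : ℝ) * x)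

/-- `s(x) = 1 / (2 sin (x / 2))`; used only for `x ∈ (0, π]`, where the sine is positive. -/
def s (x : ℝ) : ℝ := 1 / (2 * Real.sin (x / 2))

/-- `𝓔(g) = {x ∈ (0, π] : |g(x) - 1/2| < s(x)}`. -/
def envelope (g : ℝ → ℝ) : Set ℝ := {x | x ∈ Set.Ioc 0 Real.pi ∧ |g x - 1 / 2| < s x}

/-- The zeros of `f` in `[0, 2π]`. -/
def zeroSet (f : ℝ → ℝ) : Set ℝ := {x | x ∈ Set.Icc 0 (2 * Real.pi) ∧ f x = 0}

/-- The number of (distinct) zeros of `f` in `[0, 2π]`. -/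
def Z (f : ℝ → ℝ) : ℕ := (zeroSet f).ncard

/-- The number of zeros of `f` in `[0, 2π]` counted with multiplicity, for an analytic function
`f` that is not identically zero. -/
def ZMult (f : ℝ → ℝ) : ℕ := ∑ᶠ x ∈ zeroSet f, analyticOrderNatAt f x

end

end CosineZeros

namespace CosineZeros

open Real Set Filter Topology

/-! Multiplying by `2 sin (x/2)` turns `f = D n - g` into `sin ((n + 1/2) x) - h(x)`, where `h = 2
sin (x/2) (g - 1/2)` oscillates slowly and the envelope is `{|h| < 1}`. Zeros can occur only where
`|h| ≤ 1`, and since `h ^ 2 - 1` is a polynomial in `cos x` of degree at most `2m + 1`, the region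
`|h| < 1` has few boundary points (`crossings_finite_ncard_le`). So if `(0, π]` is cut into pieces
of length comparable to `1/n`, all but `2m + 1` of those meeting `|h| ≤ 1` lie inside the envelope.

Lower bound: between consecutive extrema of the sine, a piece inside the envelope contains a sign
change (`exists_zero_of_subset_envelope`).

Upper bound: for `k` large in terms of `α`, the `k`-th derivative of the sine, of size `(n + 1/2) ^
k`, beats that of `h`, at most `3 (m + 1) ^ (k + 1)`. On a short piece one of two consecutive
derivatives never vanishes, so Rolle bounds the zeros there, with multiplicity, by a constant
(`sum_order_weightedDiff_le`). This needs `n` large; the remaining `n` leave finitely many pairs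
`(n, A)`. -/

/-! ### Rolle's theorem with multiplicity -/

lemma analyticOrderAt_ne_top_of_iteratedDeriv_ne_zero {f : ℝ → ℝ} {k : ℕ} {x : ℝ}
    (hx : iteratedDeriv k f x ≠ 0) : analyticOrderAt f x ≠ ⊤ := by
  intro h
  rw [analyticOrderAt_eq_top] at h
  have h' : f =ᶠ[𝓝 x] fun _ => (0 : ℝ) := h
  apply hx
  rw [h'.iteratedDeriv_eq k]
  simp

/-- Rolle's theorem with multiplicities: passing to the derivative loses at most one zero. -/
lemma sum_analyticOrderNatAt_le_deriv {f : ℝ → ℝ} (hf : ∀ x, AnalyticAt ℝ f x) {I : Set ℝ}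
    (hI : I.OrdConnected) (htop : ∀ x ∈ I, analyticOrderAt (deriv f) x ≠ ⊤)
    (T : Finset ℝ) (hT : (T : Set ℝ) ⊆ I) :
    ∃ T' : Finset ℝ, (T' : Set ℝ) ⊆ I ∧
      ∑ x ∈ T, analyticOrderNatAt f x ≤ ∑ x ∈ T', analyticOrderNatAt (deriv f) x + 1 := by
  classical
  set S := T.filter fun x => analyticOrderNatAt f x ≠ 0 with hS
  have hST : S ⊆ T := Finset.filter_subset _ _
  have hSI : ∀ x ∈ S, x ∈ I := fun x hx => hT (hST hx)
  have hS0 : ∀ x ∈ S, f x = 0 := fun x hx =>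
    apply_eq_zero_of_analyticOrderNatAt_ne_zero (Finset.mem_filter.1 hx).2
  have hord : ∀ x ∈ S, analyticOrderNatAt f x = analyticOrderNatAt (deriv f) x + 1 := by
    intro x hx
    have hne := (Finset.mem_filter.1 hx).2
    have h := (hf x).analyticOrderAt_deriv_add_one
    simp only [hS0 x hx, sub_zero] at h
    rw [analyticOrderNatAt, ← h, analyticOrderNatAt]
    exact ENat.toNat_add (htop x (hSI x hx)) (by simp)
  have hrolle : ∀ x y : ℝ, x ∈ S → y ∈ S → x < y → ∃ z ∈ Ioo x y, deriv f z = 0 :=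
    fun x y hx hy hxy => exists_deriv_eq_zero hxy
      (fun w _ => (hf w).continuousAt.continuousWithinAt) ((hS0 x hx).trans (hS0 y hy).symm)
  choose! z hz hz' using hrolle
  set R := ((S ×ˢ S).filter fun p => p.1 < p.2).image fun p => z p.1 p.2 with hR
  have hRmem : ∀ w ∈ R, w ∈ I ∧ deriv f w = 0 := by
    intro w hw
    simp only [hR, Finset.mem_image, Finset.mem_filter, Finset.mem_product] at hw
    obtain ⟨p, ⟨⟨h1, h2⟩, h3⟩, rfl⟩ := hw
    exact ⟨hI.out (hSI _ h1) (hSI _ h2) (Ioo_subset_Icc_self (hz _ _ h1 h2 h3)),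
      hz' _ _ h1 h2 h3⟩
  -- Each zero in `S` loses one order under differentiation, `S.card` in total; the Rolle points
  -- outside `S` give back at least `S.card - 1`.
  have hcard : S.card ≤ (R \ S).card + 1 := by
    apply Finset.card_le_sdiff_of_interleaved
    intro x hx y hy hxy _
    refine ⟨z x y, ?_, hz x y hx hy hxy⟩
    simp only [hR, Finset.mem_image, Finset.mem_filter, Finset.mem_product]
    exact ⟨(x, y), ⟨⟨hx, hy⟩, hxy⟩, rfl⟩
  refine ⟨S ∪ (R \ S), ?_, ?_⟩
  · intro x hx
    simp only [Finset.coe_union, Finset.coe_sdiff, mem_union, Finset.mem_coe, Set.mem_sdiff] at hx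
    rcases hx with hx | hx
    · exact hSI x hx
    · exact (hRmem x hx.1).1
  · rw [Finset.sum_union Finset.disjoint_sdiff]
    have h1 : ∑ x ∈ T, analyticOrderNatAt f x = ∑ x ∈ S, analyticOrderNatAt f x :=
      (Finset.sum_filter_ne_zero T).symm
    have h2 : (R \ S).card ≤ ∑ x ∈ R \ S, analyticOrderNatAt (deriv f) x := by
      rw [Finset.card_eq_sum_ones]
      refine Finset.sum_le_sum fun x hx => ?_
      obtain ⟨hxI, hx0⟩ := hRmem x (Finset.mem_sdiff.1 hx).1
      rw [Nat.one_le_iff_ne_zero, analyticOrderNatAt, ne_eq, ENat.toNat_eq_zero]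
      push Not
      exact ⟨((hf x).deriv.analyticOrderAt_ne_zero).2 hx0, htop x hxI⟩
    rw [h1, Finset.sum_congr rfl hord, Finset.sum_add_distrib, ← Finset.card_eq_sum_ones]
    omega

lemma sum_analyticOrderNatAt_le_of_iteratedDeriv_ne_zero {I : Set ℝ} (hI : I.OrdConnected)
    (k : ℕ) {f : ℝ → ℝ} (hf : ∀ x, AnalyticAt ℝ f x) (hk : ∀ x ∈ I, iteratedDeriv k f x ≠ 0)
    (T : Finset ℝ) (hT : (T : Set ℝ) ⊆ I) : ∑ x ∈ T, analyticOrderNatAt f x ≤ k := by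
  induction k generalizing f T with
  | zero =>
    refine (Finset.sum_eq_zero fun x hx => ?_).le
    have := hk x (hT hx)
    rw [iteratedDeriv_zero] at this
    by_contra h
    exact this (apply_eq_zero_of_analyticOrderNatAt_ne_zero h)
  | succ k ih =>
    have hk' : ∀ x ∈ I, iteratedDeriv k (deriv f) x ≠ 0 := fun x hx => by
      rw [← iteratedDeriv_succ']; exact hk x hx
    obtain ⟨T', hT', hle⟩ := sum_analyticOrderNatAt_le_deriv hf hI
      (fun x hx => analyticOrderAt_ne_top_of_iteratedDeriv_ne_zero (hk' x hx)) T hT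
    exact hle.trans (Nat.succ_le_succ (ih (fun x => (hf x).deriv) hk' T' hT'))

/-! ### The weighted functions and the envelope -/

/-- `h(x) = 2 sin (x/2) (g(x) - 1/2)`, so that the envelope of `g` is `{|h| < 1}`. -/
noncomputable def weighted (A : Finset ℕ) (x : ℝ) : ℝ :=
  2 * sin (x / 2) * (cosPoly A x - 1 / 2)

/-- `2 sin (x/2) (D n x - g(x))`. -/
noncomputable def weightedDiff (n : ℕ) (A : Finset ℕ) (x : ℝ) : ℝ :=
  sin ((n + 1 / 2) * x) - weighted A x

lemma two_sin_half_mul_D (n : ℕ) (x : ℝ) :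
    2 * sin (x / 2) * D n x = sin (x / 2) + sin ((n + 1 / 2) * x) := by
  induction n with
  | zero => simp [D]; ring_nf
  | succ n ih =>
    have h : D (n + 1) x = D n x + cos (((n + 1 : ℕ) : ℝ) * x) := by
      rw [D, Finset.sum_range_succ]; rfl
    have e1 : (((n + 1 : ℕ) : ℝ) + 1 / 2) * x = ((n + 1 : ℕ) : ℝ) * x + x / 2 := by ring
    have e2 : ((n : ℝ) + 1 / 2) * x = ((n + 1 : ℕ) : ℝ) * x - x / 2 := by push_cast; ring
    rw [h, mul_add, ih, e1, e2, sin_add, sin_sub]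
    ring

lemma weightedDiff_eq (n : ℕ) (A : Finset ℕ) (x : ℝ) :
    weightedDiff n A x = 2 * sin (x / 2) * (D n x - cosPoly A x) := by
  rw [weightedDiff, weighted, mul_sub _ (D n x), two_sin_half_mul_D]
  ring

lemma analyticAt_cosPoly (A : Finset ℕ) (x : ℝ) : AnalyticAt ℝ (cosPoly A) x := by
  unfold cosPoly; fun_prop

lemma analyticAt_D (n : ℕ) (x : ℝ) : AnalyticAt ℝ (D n) x := by
  unfold D; fun_prop

lemma analyticAt_diff (n : ℕ) (A : Finset ℕ) (x : ℝ) :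
    AnalyticAt ℝ (fun x => D n x - cosPoly A x) x :=
  (analyticAt_D n x).sub (analyticAt_cosPoly A x)

lemma analyticAt_weightedDiff (n : ℕ) (A : Finset ℕ) (x : ℝ) :
    AnalyticAt ℝ (weightedDiff n A) x := by
  unfold weightedDiff weighted cosPoly; fun_prop

lemma continuous_weighted (A : Finset ℕ) : Continuous (weighted A) := by
  unfold weighted cosPoly; fun_prop

lemma continuous_weightedDiff (n : ℕ) (A : Finset ℕ) : Continuous (weightedDiff n A) :=
  continuous_iff_continuousAt.2 fun x => (analyticAt_weightedDiff n A x).continuousAt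

lemma sin_half_pos {x : ℝ} (h0 : 0 < x) (h1 : x < 2 * π) : 0 < sin (x / 2) :=
  sin_pos_of_pos_of_lt_pi (by linarith) (by linarith)

lemma mem_envelope_iff {A : Finset ℕ} {x : ℝ} (hx : x ∈ Ioc 0 π) :
    x ∈ envelope (cosPoly A) ↔ |weighted A x| < 1 := by
  have h : 0 < 2 * sin (x / 2) := by
    have := sin_half_pos hx.1 (by linarith [hx.2, pi_pos]); linarith
  have : x ∈ envelope (cosPoly A) ↔ |cosPoly A x - 1 / 2| < s x :=
    ⟨fun h => h.2, fun h => ⟨hx, h⟩⟩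
  rw [this, s, weighted, abs_mul, abs_of_pos h, lt_div_iff₀ h, mul_comm]

/-! ### Finiteness -/

lemma exists_polynomial_cosPoly (A : Finset ℕ) :
    ∃ Q : Polynomial ℝ, Q.natDegree ≤ cosDegree A ∧ ∀ x, cosPoly A x = Q.eval (cos x) := by
  refine ⟨∑ a ∈ A, Polynomial.Chebyshev.T ℝ a, ?_, fun x => ?_⟩
  · refine Polynomial.natDegree_sum_le_of_forall_le _ _ fun a ha => ?_
    rw [Polynomial.Chebyshev.natDegree_T]
    simpa [cosDegree] using Finset.le_sup (f := id) ha
  · simp [cosPoly, Polynomial.eval_finsetSum, Polynomial.Chebyshev.T_real_cos]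

lemma finite_roots_cos {Q : Polynomial ℝ} (hQ : Q ≠ 0) {S : Set ℝ} (hS : S ⊆ Icc 0 π)
    (h : ∀ x ∈ S, Q.eval (cos x) = 0) : S.Finite ∧ S.ncard ≤ Q.natDegree := by
  have himg : cos '' S ⊆ (Q.roots.toFinset : Set ℝ) := by
    rintro _ ⟨x, hx, rfl⟩
    simp [hQ, h x hx]
  have hinj : InjOn cos S := injOn_cos.mono hS
  refine ⟨Finite.of_finite_image ((Finset.finite_toSet _).subset himg) hinj, ?_⟩
  rw [← hinj.ncard_image]
  refine (ncard_le_ncard himg (Finset.finite_toSet _)).trans ?_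
  rw [ncard_coe_finset]
  exact (Multiset.toFinset_card_le _).trans (Polynomial.card_roots' Q)

/-- The points of `[0, π]` where `|h| = 1`. -/
def crossings (A : Finset ℕ) : Set ℝ := {x | x ∈ Icc 0 π ∧ |weighted A x| = 1}

/-- By `2 sin (x/2) ^ 2 = 1 - cos x`, the function `h ^ 2 - 1` is a polynomial `P` in `cos x`, with
`P(1) = -1`, and `cos` is injective on `[0, π]`. -/
lemma crossings_finite_ncard_le (A : Finset ℕ) :
    (crossings A).Finite ∧ (crossings A).ncard ≤ 2 * cosDegree A + 1 := by
  obtain ⟨Q, hdeg, hQ⟩ := exists_polynomial_cosPoly A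
  set P : Polynomial ℝ := 2 * (1 - Polynomial.X) * (Q - Polynomial.C (1 / 2)) ^ 2 - 1 with hP
  have hP0 : P ≠ 0 := by
    intro h
    have := congrArg (Polynomial.eval 1) h
    simp [hP] at this
  have hPdeg : P.natDegree ≤ 2 * cosDegree A + 1 := by
    have h1 : (Q - Polynomial.C (1 / 2)).natDegree ≤ cosDegree A := by
      rw [Polynomial.natDegree_sub_C]; exact hdeg
    have h2 : ((Q - Polynomial.C (1 / 2)) ^ 2).natDegree ≤ 2 * cosDegree A :=
      Polynomial.natDegree_pow_le_of_le 2 h1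
    have h3 : (2 * (1 - Polynomial.X) : Polynomial ℝ).natDegree ≤ 1 := by compute_degree
    refine (Polynomial.natDegree_sub_le _ _).trans (max_le ?_ (by simp))
    refine Polynomial.natDegree_mul_le.trans ?_
    omega
  have := finite_roots_cos hP0 (S := crossings A) (fun x hx => hx.1) (by
    intro x hx
    have h1 : weighted A x ^ 2 = 1 := by rw [← sq_abs, hx.2, one_pow]
    rw [weighted, hQ] at h1
    have h2 : cos x = 1 - 2 * sin (x / 2) ^ 2 := by
      have h3 := cos_two_mul (x / 2)
      have h4 := sin_sq_add_cos_sq (x / 2)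
      rw [mul_div_cancel₀ x two_ne_zero] at h3
      linarith
    simp only [hP, Polynomial.eval_sub, Polynomial.eval_mul, Polynomial.eval_pow,
      Polynomial.eval_ofNat, Polynomial.eval_one, Polynomial.eval_X, Polynomial.eval_C]
    rw [show 2 * (1 - cos x) = (2 * sin (x / 2)) ^ 2 by rw [h2]; ring]
    linarith [h1])
  exact ⟨this.1, this.2.trans hPdeg⟩

lemma cosPoly_zero (A : Finset ℕ) : cosPoly A 0 = A.card := by simp [cosPoly]

/-- At `0` the two sums count their frequencies, so equality forces `A = {0, ..., n}`. This excludes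
zeros at `0` and `2π`, where the weight `sin (x/2)` vanishes. -/
lemma diff_zero_ne_zero {n : ℕ} {A : Finset ℕ} (hA : cosDegree A ≤ n)
    (hf : (fun x => D n x - cosPoly A x) ≠ 0) : D n 0 - cosPoly A 0 ≠ 0 := by
  intro h
  have hsub : A ⊆ Finset.range (n + 1) := fun a ha => by
    have : a ≤ cosDegree A := Finset.le_sup (f := id) ha
    simp; omega
  have hcard : (Finset.range (n + 1)).card ≤ A.card := by
    rw [cosPoly_zero] at h
    simp only [D, mul_zero, cos_zero, Finset.sum_const, nsmul_eq_mul, mul_one] at h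
    exact_mod_cast (sub_eq_zero.1 h).le
  have := Finset.eq_of_subset_of_card_le hsub hcard
  apply hf
  funext x
  simp [D, cosPoly, this]

lemma cosPoly_reflect (A : Finset ℕ) (x : ℝ) : cosPoly A (2 * π - x) = cosPoly A x := by
  refine Finset.sum_congr rfl fun a _ => ?_
  rw [mul_sub, cos_nat_mul_two_pi_sub]

lemma D_eq_cosPoly (n : ℕ) : D n = cosPoly (Finset.range (n + 1)) := rfl

lemma finite_zeroSet {n : ℕ} {A : Finset ℕ} (hA : cosDegree A ≤ n)
    (hf : (fun x => D n x - cosPoly A x) ≠ 0) :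
    (zeroSet fun x => D n x - cosPoly A x).Finite := by
  obtain ⟨Q, -, hQ⟩ := exists_polynomial_cosPoly A
  obtain ⟨R, -, hR⟩ := exists_polynomial_cosPoly (Finset.range (n + 1))
  have hne : R - Q ≠ 0 := by
    intro h
    apply diff_zero_ne_zero hA hf
    rw [D_eq_cosPoly, hQ, hR, ← Polynomial.eval_sub, h, Polynomial.eval_zero]
  set S := {x | x ∈ Icc 0 π ∧ D n x - cosPoly A x = 0} with hS
  have hfin : S.Finite := (finite_roots_cos hne (fun x hx => hx.1) (by
    intro x hx
    rw [Polynomial.eval_sub, ← hQ, ← hR, ← D_eq_cosPoly]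
    exact hx.2)).1
  refine (hfin.union (hfin.image fun x => 2 * π - x)).subset ?_
  rintro x ⟨⟨h0, h1⟩, hx⟩
  rcases le_total x π with h | h
  · exact Or.inl ⟨⟨h0, h⟩, hx⟩
  · refine Or.inr ⟨2 * π - x, ⟨⟨by linarith, by linarith⟩, ?_⟩, by ring⟩
    rw [D_eq_cosPoly, cosPoly_reflect, cosPoly_reflect]
    exact hx

/-! ### High derivatives: the fast sine against `h` -/

lemma iteratedDeriv_sin_mul_add (b φ : ℝ) (k : ℕ) :
    iteratedDeriv k (fun x => sin (b * x + φ)) =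
      fun x => b ^ k * sin (b * x + φ + k * (π / 2)) := by
  induction k with
  | zero => simp
  | succ k ih =>
    rw [iteratedDeriv_succ, ih]
    funext x
    have h : HasDerivAt (fun x => b ^ k * sin (b * x + φ + k * (π / 2)))
        (b ^ k * (cos (b * x + φ + k * (π / 2)) * (b * 1))) x :=
      (((((hasDerivAt_id x).const_mul b).add_const φ).add_const (k * (π / 2))).sin).const_mul _
    rw [h.deriv, show b * x + φ + ((k + 1 : ℕ) : ℝ) * (π / 2)
      = b * x + φ + k * (π / 2) + π / 2 by push_cast; ring, sin_add_pi_div_two]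
    ring

lemma iteratedDeriv_sin_mul (b : ℝ) (k : ℕ) (x : ℝ) :
    iteratedDeriv k (fun x => sin (b * x)) x = b ^ k * sin (b * x + k * (π / 2)) := by
  simpa using congrFun (iteratedDeriv_sin_mul_add b 0 k) x

lemma abs_iteratedDeriv_sin_mul_le {b c : ℝ} (hb : |b| ≤ c) (k : ℕ) (x : ℝ) :
    |iteratedDeriv k (fun x => sin (b * x)) x| ≤ c ^ k := by
  rw [iteratedDeriv_sin_mul, abs_mul, abs_pow]
  calc |b| ^ k * |sin (b * x + k * (π / 2))| ≤ c ^ k * 1 :=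
        mul_le_mul (pow_le_pow_left₀ (abs_nonneg b) hb k) (abs_sin_le_one _) (abs_nonneg _)
          (pow_nonneg ((abs_nonneg b).trans hb) k)
    _ = c ^ k := mul_one _

lemma weighted_eq_sum (A : Finset ℕ) :
    weighted A = fun x => (∑ a ∈ A, (sin ((a + 1 / 2) * x) - sin ((a - 1 / 2) * x)))
      - sin (1 / 2 * x) := by
  funext x
  have h : ∀ a : ℕ, sin ((a + 1 / 2 : ℝ) * x) - sin ((a - 1 / 2 : ℝ) * x)
      = 2 * sin (x / 2) * cos (a * x) := fun a => by
    rw [show (a + 1 / 2 : ℝ) * x = a * x + x / 2 by ring,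
      show (a - 1 / 2 : ℝ) * x = a * x - x / 2 by ring, sin_add, sin_sub]
    ring
  simp only [h]
  rw [← Finset.mul_sum, weighted, cosPoly, show 1 / 2 * x = x / 2 by ring]
  ring

lemma contDiff_sin_mul (b : ℝ) (k : ℕ) : ContDiff ℝ k fun x => sin (b * x) := by fun_prop

/-- As a sum of sines, `h` has at most `2(m + 1) + 1` terms, each of frequency at most `m + 1` in
absolute value. -/
lemma abs_iteratedDeriv_weighted_le (A : Finset ℕ) (k : ℕ) (x : ℝ) :
    |iteratedDeriv k (weighted A) x| ≤ 3 * (cosDegree A + 1 : ℝ) ^ (k + 1) := by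
  set m := cosDegree A with hm
  have hle : ∀ a ∈ A, a ≤ m := fun a ha => Finset.le_sup (f := id) ha
  have hcard : A.card ≤ m + 1 := by
    have : A ⊆ Finset.range (m + 1) := fun a ha => by
      have := hle a ha
      simp; omega
    simpa using Finset.card_le_card this
  have hm0 : (0 : ℝ) ≤ m := Nat.cast_nonneg m
  have hterm : ∀ a ∈ A, |iteratedDeriv k
      (fun x => sin ((a + 1 / 2) * x) - sin ((a - 1 / 2) * x)) x| ≤ 2 * (m + 1 : ℝ) ^ k := by
    intro a ha
    have ha' : (a : ℝ) ≤ m := by exact_mod_cast hle a ha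
    have ha0 : (0 : ℝ) ≤ a := Nat.cast_nonneg a
    have e := iteratedDeriv_sub (contDiff_sin_mul (a + 1 / 2) k).contDiffAt
      (contDiff_sin_mul (a - 1 / 2) k).contDiffAt (x := x)
    have e' : iteratedDeriv k (fun x => sin ((a + 1 / 2) * x) - sin ((a - 1 / 2) * x)) x = _ := e
    rw [e', two_mul]
    refine (abs_sub _ _).trans (add_le_add ?_ ?_) <;>
    · apply abs_iteratedDeriv_sin_mul_le
      rw [abs_le]; constructor <;> linarith
  have e : iteratedDeriv k (weighted A) x = (∑ a ∈ A, iteratedDeriv k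
      (fun x => sin ((a + 1 / 2) * x) - sin ((a - 1 / 2) * x)) x)
      - iteratedDeriv k (fun x => sin (1 / 2 * x)) x := by
    rw [weighted_eq_sum, ← iteratedDeriv_fun_sum
      fun a _ => ((contDiff_sin_mul _ k).sub (contDiff_sin_mul _ k)).contDiffAt]
    exact iteratedDeriv_sub (ContDiff.sum
      fun a _ => (contDiff_sin_mul _ k).sub (contDiff_sin_mul _ k)).contDiffAt
      (contDiff_sin_mul _ k).contDiffAt
  rw [e]
  have h1 : |∑ a ∈ A, iteratedDeriv k
      (fun x => sin ((a + 1 / 2) * x) - sin ((a - 1 / 2) * x)) x|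
      ≤ (m + 1) * (2 * (m + 1 : ℝ) ^ k) := by
    refine (Finset.abs_sum_le_sum_abs _ _).trans ((Finset.sum_le_sum hterm).trans ?_)
    rw [Finset.sum_const, nsmul_eq_mul]
    exact mul_le_mul_of_nonneg_right (by exact_mod_cast hcard) (by positivity)
  have h2 : |iteratedDeriv k (fun x => sin (1 / 2 * x)) x| ≤ (m + 1 : ℝ) ^ k :=
    abs_iteratedDeriv_sin_mul_le (by rw [abs_le]; constructor <;> linarith) k x
  refine (abs_sub _ _).trans ((add_le_add h1 h2).trans ?_)
  have h3 : (m + 1 : ℝ) ^ k ≤ (m + 1) ^ (k + 1) := pow_le_pow_right₀ (by linarith) (by omega)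
  rw [pow_succ'] at h3 ⊢
  linarith

lemma iteratedDeriv_weightedDiff (n : ℕ) (A : Finset ℕ) (k : ℕ) (x : ℝ) :
    iteratedDeriv k (weightedDiff n A) x =
      (n + 1 / 2 : ℝ) ^ k * sin ((n + 1 / 2) * x + k * (π / 2))
        - iteratedDeriv k (weighted A) x := by
  rw [← iteratedDeriv_sin_mul]
  refine iteratedDeriv_sub (contDiff_sin_mul _ k).contDiffAt ?_
  rw [weighted_eq_sum]
  exact ((ContDiff.sum fun a _ => (contDiff_sin_mul _ k).sub (contDiff_sin_mul _ k)).sub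
    (contDiff_sin_mul _ k)).contDiffAt

lemma iteratedDeriv_weightedDiff_ne_zero {n : ℕ} {A : Finset ℕ} {k : ℕ} {x : ℝ}
    (hk : 3 * (cosDegree A + 1 : ℝ) ^ (k + 1) < (n + 1 / 2 : ℝ) ^ k * (1 / 4))
    (hx : 1 / 4 ≤ |sin ((n + 1 / 2) * x + k * (π / 2))|) :
    iteratedDeriv k (weightedDiff n A) x ≠ 0 := by
  rw [iteratedDeriv_weightedDiff]
  intro h
  have h1 := abs_iteratedDeriv_weighted_le A k x
  rw [← sub_eq_zero.1 h, abs_mul, abs_of_pos (by positivity)] at h1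
  have := mul_le_mul_of_nonneg_left hx (by positivity : (0 : ℝ) ≤ (n + 1 / 2 : ℝ) ^ k)
  linarith

lemma abs_sin_sub_sin_le (x y : ℝ) : |sin x - sin y| ≤ |x - y| := by
  rw [show sin x - sin y = 2 * sin ((x - y) / 2) * cos ((x + y) / 2) from sin_sub_sin x y,
    abs_mul, abs_mul, abs_two]
  have h1 := abs_sin_le_abs (x := (x - y) / 2)
  have h2 := abs_cos_le_one ((x + y) / 2)
  rw [abs_div, abs_two] at h1
  nlinarith [abs_nonneg (sin ((x - y) / 2)), abs_nonneg (cos ((x + y) / 2))]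

/-- On a short interval the zeros of `2 sin (x/2) (D n - g)` are at most `K + 1` in number. -/
lemma sum_order_weightedDiff_le {n : ℕ} {A : Finset ℕ} {K : ℕ}
    (hK : ∀ k ∈ Icc K (K + 1),
      3 * (cosDegree A + 1 : ℝ) ^ (k + 1) < (n + 1 / 2 : ℝ) ^ k * (1 / 4))
    {I : Set ℝ} (hI : I.OrdConnected) {y : ℝ} (hy : ∀ x ∈ I, |(n + 1 / 2) * x - y| ≤ π / 8)
    (T : Finset ℝ) (hT : (T : Set ℝ) ⊆ I) :
    ∑ x ∈ T, analyticOrderNatAt (weightedDiff n A) x ≤ K + 1 := by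
  -- The phase moves by at most `π/8` from `y`, so a sine of size `7/10` at `y` stays above `7/10 -
  -- 2/5 > 1/4`.
  have hpi : π / 8 ≤ 2 / 5 := by have := pi_lt_d2; linarith
  have key : ∀ k : ℕ, 7 / 10 ≤ |sin (y + k * (π / 2))| → k ∈ Icc K (K + 1) →
      ∑ x ∈ T, analyticOrderNatAt (weightedDiff n A) x ≤ K + 1 := by
    intro k hk hkK
    refine (sum_analyticOrderNatAt_le_of_iteratedDeriv_ne_zero hI k
      (analyticAt_weightedDiff n A) (fun x hx => ?_) T hT).trans hkK.2
    refine iteratedDeriv_weightedDiff_ne_zero (hK k hkK) ?_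
    have h1 := abs_sin_sub_sin_le ((n + 1 / 2) * x + k * (π / 2)) (y + k * (π / 2))
    rw [add_sub_add_right_eq_sub] at h1
    have h2 := hy x hx
    have h3 := abs_sub_abs_le_abs_sub (sin (y + k * (π / 2)))
      (sin ((n + 1 / 2) * x + k * (π / 2)))
    rw [abs_sub_comm] at h3
    linarith
  -- Passing from `K` to `K + 1` turns the sine into a cosine, and both cannot be below `7/10`
  -- because `2 * 0.49 < 1`.
  by_cases h : 7 / 10 ≤ |sin (y + K * (π / 2))|
  · exact key K h ⟨le_rfl, Nat.le_succ K⟩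
  · refine key (K + 1) ?_ ⟨Nat.le_succ K, le_rfl⟩
    rw [show y + ((K + 1 : ℕ) : ℝ) * (π / 2) = y + K * (π / 2) + π / 2 by push_cast; ring,
      sin_add_pi_div_two]
    by_contra h'
    push Not at h h'
    have h1 := sin_sq_add_cos_sq (y + K * (π / 2))
    rw [← sq_abs, ← sq_abs (cos _)] at h1
    nlinarith [abs_nonneg (sin (y + K * (π / 2))), abs_nonneg (cos (y + K * (π / 2)))]

/-- For `α (k + 1) > 1` the `k`-th derivative of `sin ((n + 1/2) x)` eventually dominates. -/
lemma eventually_pow_lt {α : ℝ} (hα : 0 < α) (hα1 : α < 1) {k : ℕ} (hk : 1 < α * (k + 1)) :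
    ∀ᶠ n : ℕ in atTop, ∀ m : ℕ, (m : ℝ) ≤ (n : ℝ) ^ (1 - α) →
      3 * (m + 1 : ℝ) ^ (k + 1) < (n + 1 / 2 : ℝ) ^ k * (1 / 4) := by
  have hε : 0 < α * (k + 1) - 1 := by linarith
  -- Since `m + 1 ≤ 2 n ^ (1 - α)`, the ratio of `n ^ k` to `(m + 1) ^ (k + 1)` is at least `n ^ (α
  -- (k + 1) - 1) / 2 ^ (k + 1)`; it has to exceed `12`.
  have h1 := ((tendsto_rpow_atTop hε).comp tendsto_natCast_atTop_atTop).eventually_gt_atTop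
    (12 * 2 ^ (k + 1) : ℝ)
  filter_upwards [h1, eventually_ge_atTop 1] with n hn hn1 m hm
  have hn0 : (1 : ℝ) ≤ n := by exact_mod_cast hn1
  have hnpos : (0 : ℝ) < n := by linarith
  have hone : (1 : ℝ) ≤ (n : ℝ) ^ (1 - α) := one_le_rpow hn0 (by linarith)
  have h2 : (m + 1 : ℝ) ^ (k + 1) ≤ 2 ^ (k + 1) * (n : ℝ) ^ ((1 - α) * (k + 1)) := by
    calc (m + 1 : ℝ) ^ (k + 1) ≤ (2 * (n : ℝ) ^ (1 - α)) ^ (k + 1) :=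
          pow_le_pow_left₀ (by positivity) (by linarith) _
      _ = 2 ^ (k + 1) * (n : ℝ) ^ ((1 - α) * (k + 1)) := by
          rw [mul_pow, rpow_mul hnpos.le]
          congr 1
          rw [← rpow_natCast]; push_cast; rfl
  have h3 : (n : ℝ) ^ ((1 - α) * (k + 1)) * (n : ℝ) ^ (α * (k + 1) - 1) = (n : ℝ) ^ k := by
    rw [← rpow_add hnpos, ← rpow_natCast]
    congr 1; ring
  have h4 : (n : ℝ) ^ k ≤ (n + 1 / 2 : ℝ) ^ k := pow_le_pow_left₀ hnpos.le (by linarith) _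
  have h5 : 0 < (n : ℝ) ^ ((1 - α) * (k + 1)) := rpow_pos_of_pos hnpos _
  have h6 := mul_lt_mul_of_pos_left hn h5
  simp only [Function.comp] at h6
  rw [h3] at h6
  linarith

/-! ### Disjoint intervals: boundary points and measure -/

lemma exists_mem_crossings {A : Finset ℕ} {I : Set ℝ} (hI : IsPreconnected I)
    (hsub : I ⊆ Icc 0 π) {p q : ℝ} (hp : p ∈ I) (hq : q ∈ I) (hp1 : |weighted A p| ≤ 1)
    (hq1 : 1 ≤ |weighted A q|) : ∃ x ∈ I, x ∈ crossings A := by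
  obtain ⟨x, hx, hx1⟩ := hI.intermediate_value hp hq
    (continuous_weighted A).abs.continuousOn ⟨hp1, hq1⟩
  exact ⟨x, hx, hsub hx, hx1⟩

lemma card_le_of_meets_crossings {A : Finset ℕ} {I : ℕ → Set ℝ}
    (hd : Pairwise fun i j => Disjoint (I i) (I j)) (J : Finset ℕ)
    (hJ : ∀ j ∈ J, ∃ x ∈ I j, x ∈ crossings A) : J.card ≤ 2 * cosDegree A + 1 := by
  obtain ⟨hfin, hcard⟩ := crossings_finite_ncard_le A
  choose! z hz hzc using hJ
  refine le_trans ?_ hcard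
  rw [ncard_eq_toFinset_card _ hfin]
  refine Finset.card_le_card_of_injOn z (fun j hj => by simpa using hzc j hj) ?_
  intro i hi j hj hij
  by_contra hne
  exact disjoint_left.1 (hd hne) (hz i hi) (hij ▸ hz j hj)

lemma envelope_subset (g : ℝ → ℝ) : envelope g ⊆ Ioc 0 π := fun _ hx => hx.1

lemma volume_envelope_ne_top (g : ℝ → ℝ) : volume (envelope g) ≠ ⊤ :=
  ((measure_mono (envelope_subset g)).trans_lt measure_Ioc_lt_top).ne

lemma card_mul_le_volume_envelope {g : ℝ → ℝ} {I : ℕ → Set ℝ} {δ : ℝ}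
    (hd : Pairwise fun i j => Disjoint (I i) (I j)) (hm : ∀ j, MeasurableSet (I j))
    (hv : ∀ j, volume.real (I j) = δ) (J : Finset ℕ) (hJ : ∀ j ∈ J, I j ⊆ envelope g) :
    J.card * δ ≤ volume.real (envelope g) := by
  have hsub : (⋃ j ∈ J, I j) ⊆ envelope g := iUnion₂_subset hJ
  have h := measureReal_mono (μ := volume) hsub (volume_envelope_ne_top g)
  rw [measureReal_biUnion_finset (fun i _ j _ hij => hd hij) (fun j _ => hm j)
    (fun j hj => ((measure_mono (hJ j hj)).trans_lt (volume_envelope_ne_top g).lt_top).ne)] at h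
  simpa [hv] using h

/-! ### Upper bound -/

lemma sum_order_weightedDiff_le_volume {n : ℕ} {A : Finset ℕ} {K : ℕ}
    (hK : ∀ k ∈ Icc K (K + 1),
      3 * (cosDegree A + 1 : ℝ) ^ (k + 1) < (n + 1 / 2 : ℝ) ^ k * (1 / 4))
    (T : Finset ℝ) (hT : (T : Set ℝ) ⊆ Ioc 0 π) :
    (∑ x ∈ T, analyticOrderNatAt (weightedDiff n A) x : ℕ) ≤
      (K + 1 : ℝ) * ((4 * n + 2) / π * volume.real (envelope (cosPoly A))
        + (2 * cosDegree A + 1)) := by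
  classical
  -- The `4n + 2` cells of length `δ` tile `(0, π]`; across each the phase `(n + 1/2) x` advances by
  -- `π/4`, hence stays within `π/8` of its midpoint value.
  set δ : ℝ := π / (4 * n + 2) with hδ
  have hM : (0 : ℝ) < 4 * n + 2 := by positivity
  have hδ0 : 0 < δ := div_pos pi_pos hM
  have hMδ : ((4 * n + 2 : ℕ) : ℝ) * δ = π := by rw [hδ]; push_cast; field_simp
  set I : ℕ → Set ℝ := fun j => Ioc (j * δ) ((j + 1 : ℕ) * δ) with hI
  have hmono : Monotone fun j : ℕ => (j : ℝ) * δ := fun i j hij =>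
    mul_le_mul_of_nonneg_right (by exact_mod_cast hij) hδ0.le
  have hd : Pairwise fun i j => Disjoint (I i) (I j) := hmono.pairwise_disjoint_on_Ioc_succ
  have hv : ∀ j, volume.real (I j) = δ := fun j => by
    rw [hI, Real.volume_real_Ioc_of_le (hmono (Nat.le_succ j))]; push_cast; ring
  set S := T.filter fun x => analyticOrderNatAt (weightedDiff n A) x ≠ 0 with hS
  -- Cells are open on the left, hence ceiling minus one; the subtraction is not truncated for `x >
  -- 0`.
  set φ : ℝ → ℕ := fun x => ⌈x / δ⌉₊ - 1 with hφ
  have hφI : ∀ x ∈ Ioc 0 π, x ∈ I (φ x) ∧ φ x + 1 ≤ 4 * n + 2 := by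
    intro x hx
    have hpos : 0 < ⌈x / δ⌉₊ := Nat.ceil_pos.2 (div_pos hx.1 hδ0)
    have e : φ x + 1 = ⌈x / δ⌉₊ := Nat.sub_add_cancel hpos
    refine ⟨⟨?_, ?_⟩, ?_⟩
    · rw [← lt_div_iff₀ hδ0]
      exact Nat.lt_ceil.1 (by omega)
    · rw [← div_le_iff₀ hδ0, e]
      exact Nat.le_ceil _
    · rw [e, Nat.ceil_le, div_le_iff₀ hδ0, hMδ]
      exact hx.2
  have hIsub : ∀ j, j + 1 ≤ 4 * n + 2 → I j ⊆ Ioc 0 π := fun j hj x hx =>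
    ⟨lt_of_le_of_lt (by positivity) hx.1, hx.2.trans ((hmono hj).trans hMδ.le)⟩
  have hST : ∀ x ∈ S, x ∈ Ioc 0 π := fun x hx => hT (Finset.mem_filter.1 hx).1
  have hcell : ∀ j, ∑ x ∈ S with φ x = j, analyticOrderNatAt (weightedDiff n A) x ≤ K + 1 := by
    intro j
    refine sum_order_weightedDiff_le hK (ordConnected_Ioc : (I j).OrdConnected)
      (y := (j + 1 / 2) * (π / 4)) (fun x hx => ?_) _ ?_
    · have e : ((n : ℝ) + 1 / 2) * δ = π / 4 := by rw [hδ]; field_simp; ring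
      have hN : (0 : ℝ) ≤ n + 1 / 2 := by positivity
      have h1 := mul_le_mul_of_nonneg_left hx.1.le hN
      have h2 := mul_le_mul_of_nonneg_left hx.2 hN
      rw [mul_left_comm, e] at h1 h2
      push_cast at h2
      rw [abs_le]; constructor <;> linarith
    · intro x hx
      obtain ⟨hxS, rfl⟩ := Finset.mem_filter.1 hx
      exact (hφI x (hST x hxS)).1
  set J := S.image φ with hJ
  have hsum : ∑ x ∈ T, analyticOrderNatAt (weightedDiff n A) x ≤ J.card * (K + 1) := by
    rw [← Finset.sum_filter_ne_zero T,
      ← Finset.sum_fiberwise_of_maps_to fun x hx => Finset.mem_image_of_mem φ hx]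
    exact Finset.sum_le_card_nsmul _ _ _ fun j _ => hcell j
  have hJprop : ∀ j ∈ J, j + 1 ≤ 4 * n + 2 ∧ ∃ x ∈ I j, |weighted A x| ≤ 1 := by
    intro j hj
    obtain ⟨x, hx, rfl⟩ := Finset.mem_image.1 hj
    obtain ⟨h1, h2⟩ := hφI x (hST x hx)
    have h0 := apply_eq_zero_of_analyticOrderNatAt_ne_zero (Finset.mem_filter.1 hx).2
    refine ⟨h2, x, h1, ?_⟩
    rw [← sub_eq_zero.1 h0]
    exact abs_sin_le_one _
  have hfull : ((J.filter fun j => I j ⊆ envelope (cosPoly A)).card : ℝ) * δ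
      ≤ volume.real (envelope (cosPoly A)) :=
    card_mul_le_volume_envelope hd (fun _ => measurableSet_Ioc) hv _
      fun j hj => (Finset.mem_filter.1 hj).2
  -- An occupied cell has `|h| ≤ 1` at its zero; if it leaves the envelope, then `|h| = 1` somewhere
  -- in it.
  have hcross : (J.filter fun j => ¬ I j ⊆ envelope (cosPoly A)).card ≤ 2 * cosDegree A + 1 := by
    refine card_le_of_meets_crossings hd _ fun j hj => ?_
    obtain ⟨hjJ, hjE⟩ := Finset.mem_filter.1 hj
    obtain ⟨h1, p, hp, hp1⟩ := hJprop j hjJ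
    obtain ⟨q, hq, hqE⟩ := not_subset.1 hjE
    rw [mem_envelope_iff (hIsub j h1 hq), not_lt] at hqE
    exact exists_mem_crossings isPreconnected_Ioc ((hIsub j h1).trans Ioc_subset_Icc_self)
      hp hq hp1 hqE
  have hcard := Finset.card_filter_add_card_filter_not (s := J)
    (fun j => I j ⊆ envelope (cosPoly A))
  have hcard' : (J.card : ℝ) ≤ (4 * n + 2) / π * volume.real (envelope (cosPoly A))
      + (2 * cosDegree A + 1) := by
    rw [← hcard]
    push_cast
    refine add_le_add ?_ (by exact_mod_cast hcross)
    rw [div_mul_eq_mul_div, le_div_iff₀ pi_pos, ← hMδ]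
    push_cast
    linarith [mul_le_mul_of_nonneg_left hfull hM.le]
  calc ((∑ x ∈ T, analyticOrderNatAt (weightedDiff n A) x : ℕ) : ℝ)
      ≤ (J.card * (K + 1) : ℕ) := by exact_mod_cast hsum
    _ = (K + 1 : ℝ) * J.card := by push_cast; ring
    _ ≤ _ := mul_le_mul_of_nonneg_left hcard' (by positivity)

lemma analyticOrderAt_diff_ne_top {n : ℕ} {A : Finset ℕ}
    (hf : (fun x => D n x - cosPoly A x) ≠ 0) (x : ℝ) :
    analyticOrderAt (fun x => D n x - cosPoly A x) x ≠ ⊤ := by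
  intro h
  rw [analyticOrderAt_eq_top] at h
  exact hf (AnalyticOnNhd.eq_of_eventuallyEq (𝕜 := ℝ)
    (fun y _ => analyticAt_diff n A y) (fun y _ => analyticAt_const) h)

lemma analyticOrderNatAt_diff_le {n : ℕ} {A : Finset ℕ}
    (hf : (fun x => D n x - cosPoly A x) ≠ 0) {x : ℝ} (hx : x ∈ Ioc 0 π) :
    analyticOrderNatAt (fun x => D n x - cosPoly A x) x
      ≤ analyticOrderNatAt (weightedDiff n A) x := by
  have hs : AnalyticAt ℝ (fun x : ℝ => 2 * sin (x / 2)) x := by fun_prop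
  have hs0 : analyticOrderAt (fun x : ℝ => 2 * sin (x / 2)) x = 0 := by
    rw [hs.analyticOrderAt_eq_zero]
    have := sin_half_pos hx.1 (by linarith [hx.2, pi_pos])
    positivity
  have e : weightedDiff n A = (fun x => 2 * sin (x / 2)) * fun x => D n x - cosPoly A x :=
    funext fun x => weightedDiff_eq n A x
  rw [e, analyticOrderNatAt_mul hs (analyticAt_diff n A x) (by rw [hs0]; simp)
    (analyticOrderAt_diff_ne_top hf x)]
  exact Nat.le_add_left _ _

lemma analyticOrderNatAt_diff_reflect (n : ℕ) (A : Finset ℕ) (x : ℝ) :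
    analyticOrderNatAt (fun x => D n x - cosPoly A x) (2 * π - x)
      = analyticOrderNatAt (fun x => D n x - cosPoly A x) x := by
  have hg : AnalyticAt ℝ (fun x : ℝ => 2 * π - x) x := by fun_prop
  have hg' : HasDerivAt (fun x : ℝ => 2 * π - x) (-1) x := (hasDerivAt_id x).const_sub _
  have h := analyticOrderAt_comp_of_deriv_ne_zero (f := fun x => D n x - cosPoly A x) hg
    (by rw [hg'.deriv]; norm_num)
  rw [analyticOrderNatAt, ← h, analyticOrderNatAt]
  congr 2
  funext x
  simp only [Function.comp, D_eq_cosPoly, cosPoly_reflect]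

lemma ZMult_eq_sum {f : ℝ → ℝ} (hfin : (zeroSet f).Finite) :
    ZMult f = ∑ x ∈ hfin.toFinset, analyticOrderNatAt f x :=
  finsum_mem_eq_finite_toFinset_sum _ hfin

lemma Z_le_ZMult {n : ℕ} {A : Finset ℕ} (hA : cosDegree A ≤ n)
    (hf : (fun x => D n x - cosPoly A x) ≠ 0) :
    Z (fun x => D n x - cosPoly A x) ≤ ZMult fun x => D n x - cosPoly A x := by
  rw [ZMult_eq_sum (finite_zeroSet hA hf), Z, ncard_eq_toFinset_card _ (finite_zeroSet hA hf),
    Finset.card_eq_sum_ones]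
  refine Finset.sum_le_sum fun x hx => ?_
  rw [Finite.mem_toFinset] at hx
  rw [Nat.one_le_iff_ne_zero, analyticOrderNatAt, ne_eq, ENat.toNat_eq_zero]
  push Not
  exact ⟨((analyticAt_diff n A x).analyticOrderAt_ne_zero).2 hx.2,
    analyticOrderAt_diff_ne_top hf x⟩

lemma ZMult_le {n : ℕ} {A : Finset ℕ} {K : ℕ} (hA : cosDegree A ≤ n)
    (hf : (fun x => D n x - cosPoly A x) ≠ 0)
    (hK : ∀ k ∈ Icc K (K + 1),
      3 * (cosDegree A + 1 : ℝ) ^ (k + 1) < (n + 1 / 2 : ℝ) ^ k * (1 / 4)) :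
    (ZMult (fun x => D n x - cosPoly A x) : ℝ) ≤
      2 * ((K + 1 : ℝ) * ((4 * n + 2) / π * volume.real (envelope (cosPoly A))
        + (2 * cosDegree A + 1))) := by
  classical
  set f : ℝ → ℝ := fun x => D n x - cosPoly A x with hfdef
  have hfin : (zeroSet f).Finite := finite_zeroSet hA hf
  set S := hfin.toFinset with hS
  have hS' : ∀ x ∈ S, 0 < x ∧ x < 2 * π := by
    intro x hx
    obtain ⟨⟨h0, h1⟩, hx0⟩ := hfin.mem_toFinset.1 hx
    have hz := diff_zero_ne_zero hA hf
    refine ⟨lt_of_le_of_ne h0 ?_, lt_of_le_of_ne h1 ?_⟩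
    · rintro rfl
      exact hz hx0
    · rintro rfl
      apply hz
      have h := cosPoly_reflect (Finset.range (n + 1)) (2 * π)
      have h' := cosPoly_reflect A (2 * π)
      rw [sub_self] at h h'
      rw [D_eq_cosPoly, h, h']
      exact hx0
  have hbound : ∀ T : Finset ℝ, (T : Set ℝ) ⊆ Ioc 0 π →
      (∑ x ∈ T, analyticOrderNatAt f x : ℕ) ≤
      (K + 1 : ℝ) * ((4 * n + 2) / π * volume.real (envelope (cosPoly A))
        + (2 * cosDegree A + 1)) := fun T hT =>
    le_trans (Nat.cast_le.2 (Finset.sum_le_sum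
      fun x hx => analyticOrderNatAt_diff_le hf (hT hx)))
      (sum_order_weightedDiff_le_volume hK T hT)
  have h1 := hbound (S.filter fun x => x ≤ π) fun x hx => by
    obtain ⟨hxS, hxπ⟩ := Finset.mem_filter.1 hx
    exact ⟨(hS' x hxS).1, hxπ⟩
  -- The symmetry `x ↦ 2π - x` preserves orders and carries the zeros beyond `π` into `(0, π)`.
  have h2 := hbound ((S.filter fun x => ¬ x ≤ π).image fun x => 2 * π - x) fun x hx => by
    obtain ⟨y, hy, rfl⟩ := Finset.mem_image.1 hx
    obtain ⟨hyS, hyπ⟩ := Finset.mem_filter.1 hy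
    have := (hS' y hyS).2
    exact ⟨by linarith, by linarith⟩
  rw [Finset.sum_image (fun x _ y _ h => by simpa using h),
    Finset.sum_congr rfl fun x _ => analyticOrderNatAt_diff_reflect n A x] at h2
  have h3 : ZMult f = ∑ x ∈ S with x ≤ π, analyticOrderNatAt f x
      + ∑ x ∈ S with ¬ x ≤ π, analyticOrderNatAt f x := by
    rw [Finset.sum_filter_add_sum_filter_not]
    exact ZMult_eq_sum hfin
  rw [h3, two_mul]
  push_cast at h1 h2 ⊢
  exact add_le_add h1 h2

/-! ### Lower bound -/

/-- The extremal points of `sin ((n + 1/2) x)`. -/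
noncomputable def node (n j : ℕ) : ℝ := (j + 1 / 2) * (π / (n + 1 / 2))

lemma node_mono (n : ℕ) : Monotone (node n) := fun i j hij => by
  have : (i : ℝ) ≤ j := by exact_mod_cast hij
  unfold node
  gcongr

lemma node_pos (n j : ℕ) : 0 < node n j := by
  have := pi_pos
  unfold node
  positivity

lemma node_self (n : ℕ) : node n n = π := by
  unfold node; field_simp

lemma node_le_pi {n j : ℕ} (hj : j ≤ n) : node n j ≤ π := (node_mono n hj).trans (node_self n).le

lemma node_succ_sub (n j : ℕ) : node n (j + 1) - node n j = π / (n + 1 / 2) := by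
  unfold node; push_cast; ring

lemma sin_node (n j : ℕ) : sin ((n + 1 / 2) * node n j) = (-1) ^ j := by
  rw [show ((n : ℝ) + 1 / 2) * node n j = j * π + π / 2 by unfold node; field_simp,
    sin_add_pi_div_two, cos_nat_mul_pi]

lemma Ico_node_subset {n j : ℕ} (hj : j < n) : Ico (node n j) (node n (j + 1)) ⊆ Ioo 0 π :=
  fun _ hx => ⟨(node_pos n j).trans_le hx.1, hx.2.trans_le (node_le_pi hj)⟩

/-- The sine is `±1` with opposite signs at the two nodes, so `|h| < 1` forces a sign change. At the
right node only `|h| ≤ 1` is known, by continuity, so the zero may sit there but not at the left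
node; the intervals `Ioc` being disjoint, no zero is counted twice. -/
lemma exists_zero_of_subset_envelope {n : ℕ} {A : Finset ℕ} {j : ℕ} (hj : j < n)
    (h : Ico (node n j) (node n (j + 1)) ⊆ envelope (cosPoly A)) :
    ∃ z ∈ Ioc (node n j) (node n (j + 1)), z ∈ zeroSet fun x => D n x - cosPoly A x := by
  have hlt : node n j < node n (j + 1) := by
    have := node_succ_sub n j
    have : 0 < π / ((n : ℝ) + 1 / 2) := by have := pi_pos; positivity
    linarith
  have h1 : ∀ x ∈ Ico (node n j) (node n (j + 1)), |weighted A x| < 1 := fun x hx =>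
    (mem_envelope_iff (h hx).1).1 (h hx)
  have h2 : |weighted A (node n (j + 1))| ≤ 1 := by
    have hcl : IsClosed {x | |weighted A x| ≤ 1} :=
      isClosed_le (continuous_weighted A).abs continuous_const
    have := closure_minimal (fun x hx => (h1 x hx).le) hcl
    rw [closure_Ico hlt.ne] at this
    exact this (right_mem_Icc.2 hlt.le)
  have h1' := abs_lt.1 (h1 _ (left_mem_Ico.2 hlt))
  have h2' := abs_le.1 h2
  have hcont : ContinuousOn (fun x => (-1) ^ j * weightedDiff n A x)
      (Icc (node n j) (node n (j + 1))) :=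
    (continuous_const.mul (continuous_weightedDiff n A)).continuousOn
  have hleft : 0 < (-1) ^ j * weightedDiff n A (node n j) := by
    rw [weightedDiff, sin_node]
    rcases neg_one_pow_eq_or ℝ j with e | e <;> rw [e] <;> linarith
  have hright : (-1) ^ j * weightedDiff n A (node n (j + 1)) ≤ 0 := by
    rw [weightedDiff, sin_node, pow_succ]
    rcases neg_one_pow_eq_or ℝ j with e | e <;> rw [e] <;> linarith
  obtain ⟨z, hz, hz0⟩ := intermediate_value_Icc' hlt.le hcont ⟨hright, hleft.le⟩
  have hzne : node n j ≠ z := by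
    rintro rfl
    exact hleft.ne' hz0
  have hz1 : node n j < z := lt_of_le_of_ne hz.1 hzne
  have hzpos : 0 < z := (node_pos n j).trans hz1
  have hzpi : z ≤ π := hz.2.trans (node_le_pi hj)
  refine ⟨z, ⟨hz1, hz.2⟩, ⟨hzpos.le, by linarith [pi_pos]⟩, ?_⟩
  have hs := sin_half_pos hzpos (by linarith [pi_pos])
  simp only [weightedDiff_eq] at hz0
  rcases mul_eq_zero.1 hz0 with h | h
  · exact absurd h (pow_ne_zero _ (by norm_num))
  · exact (mul_eq_zero.1 h).resolve_left (by positivity)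

lemma card_le_Z {n : ℕ} {A : Finset ℕ} (hA : cosDegree A ≤ n)
    (hf : (fun x => D n x - cosPoly A x) ≠ 0) (J : Finset ℕ) (hJ : ∀ j ∈ J, j < n)
    (hJE : ∀ j ∈ J, Ico (node n j) (node n (j + 1)) ⊆ envelope (cosPoly A)) :
    J.card ≤ Z fun x => D n x - cosPoly A x := by
  have hfin := finite_zeroSet hA hf
  have hex := fun j hj => exists_zero_of_subset_envelope (hJ j hj) (hJE j hj)
  choose! z hz hz0 using hex
  rw [Z, ncard_eq_toFinset_card _ hfin]
  refine Finset.card_le_card_of_injOn z (fun j hj => by simpa using hz0 j hj) ?_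
  intro i hi j hj hij
  by_contra hne
  exact disjoint_left.1 ((node_mono n).pairwise_disjoint_on_Ioc_succ hne) (hz i hi)
    (hij ▸ hz j hj)

/-- Each node interval meeting the envelope either lies inside it and yields its own zero, or
contains one of the `2m + 1` crossings. The term `1/2` pays for the half-length piece before the
first node. -/
lemma volume_envelope_le_Z {n : ℕ} {A : Finset ℕ} (hA : cosDegree A ≤ n)
    (hf : (fun x => D n x - cosPoly A x) ≠ 0) :
    volume.real (envelope (cosPoly A)) ≤ (π / (n + 1 / 2)) *
      (1 / 2 + Z (fun x => D n x - cosPoly A x) + (2 * cosDegree A + 1)) := by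
  classical
  set I : ℕ → Set ℝ := fun j => Ico (node n j) (node n (j + 1)) with hI
  set E := envelope (cosPoly A) with hE
  have hd : Pairwise fun i j => Disjoint (I i) (I j) := (node_mono n).pairwise_disjoint_on_Ico_succ
  have hv : ∀ j, volume.real (I j) = π / (n + 1 / 2) := fun j => by
    rw [hI, Real.volume_real_Ico_of_le (node_mono n (Nat.le_succ j)), node_succ_sub]
  set J := (Finset.range n).filter fun j => (I j ∩ E).Nonempty with hJ
  have hJn : ∀ j ∈ J, j < n := fun j hj => Finset.mem_range.1 (Finset.mem_filter.1 hj).1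
  have hcover : E ⊆ (Ioo 0 (node n 0) ∪ ⋃ j ∈ J, I j) ∪ {π} := by
    intro x hx
    have hx1 : x ∈ Ioc 0 π := hx.1
    by_cases h0 : x < node n 0
    · exact Or.inl (Or.inl ⟨hx1.1, h0⟩)
    by_cases hpi : x = π
    · exact Or.inr hpi
    have hxpi : x < π := lt_of_le_of_ne hx1.2 hpi
    rw [not_lt] at h0
    obtain ⟨j, hj, hxj⟩ : ∃ j < n, x ∈ I j := by
      have hex : ∃ j, x < node n j := ⟨n, by rwa [node_self]⟩
      have hpos : Nat.find hex ≠ 0 := fun h => by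
        have := Nat.find_spec hex
        rw [h] at this
        linarith
      have hle : Nat.find hex ≤ n := Nat.find_min' hex (by rwa [node_self])
      refine ⟨Nat.find hex - 1, by omega, ?_, ?_⟩
      · exact not_lt.1 (Nat.find_min hex (by omega))
      · rw [Nat.sub_add_cancel (Nat.one_le_iff_ne_zero.2 hpos)]
        exact Nat.find_spec hex
    refine Or.inl (Or.inr (mem_iUnion₂.2 ⟨j, ?_, hxj⟩))
    exact Finset.mem_filter.2 ⟨Finset.mem_range.2 hj, x, hxj, hx⟩
  have hfull : (J.filter fun j => I j ⊆ E).card ≤ Z fun x => D n x - cosPoly A x :=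
    card_le_Z hA hf _ (fun j hj => hJn j (Finset.mem_filter.1 hj).1)
      fun j hj => (Finset.mem_filter.1 hj).2
  have hcross : (J.filter fun j => ¬ I j ⊆ E).card ≤ 2 * cosDegree A + 1 := by
    refine card_le_of_meets_crossings hd _ fun j hj => ?_
    obtain ⟨hjJ, hjE⟩ := Finset.mem_filter.1 hj
    have hsub := Ico_node_subset (hJn j hjJ)
    obtain ⟨p, hp, hpE⟩ := (Finset.mem_filter.1 hjJ).2
    obtain ⟨q, hq, hqE⟩ := not_subset.1 hjE
    rw [hE, mem_envelope_iff (Ioo_subset_Ioc_self (hsub hq)), not_lt] at hqE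
    rw [hE, mem_envelope_iff hpE.1] at hpE
    exact exists_mem_crossings isPreconnected_Ico (hsub.trans Ioo_subset_Icc_self)
      hp hq hpE.le hqE
  have hcard := Finset.card_filter_add_card_filter_not (s := J) (fun j => I j ⊆ E)
  have hcard' : (J.card : ℝ) ≤ Z (fun x => D n x - cosPoly A x) + (2 * cosDegree A + 1) := by
    rw [← hcard]
    exact_mod_cast add_le_add hfull hcross
  have hvol : volume.real E ≤ node n 0 + J.card * (π / (n + 1 / 2)) := by
    have hbU : volume.real (⋃ j ∈ J, I j) ≤ J.card * (π / (n + 1 / 2)) := by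
      refine (measureReal_biUnion_finset_le J I).trans ?_
      simp [hv]
    have hnode : volume.real (Ioo 0 (node n 0)) = node n 0 := by
      rw [Real.volume_real_Ioo_of_le (node_pos n 0).le, sub_zero]
    have hne : volume ((Ioo 0 (node n 0) ∪ ⋃ j ∈ J, I j) ∪ {π}) ≠ ⊤ := by
      refine measure_union_ne_top (measure_union_ne_top measure_Ioo_lt_top.ne ?_) (by simp)
      exact (measure_biUnion_lt_top J.finite_toSet fun j _ => measure_Ico_lt_top).ne
    refine (measureReal_mono hcover hne).trans ((measureReal_union_le _ _).trans ?_)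
    have hs : volume.real ({π} : Set ℝ) = 0 := by simp [measureReal_def]
    have := measureReal_union_le (μ := volume) (Ioo 0 (node n 0)) (⋃ j ∈ J, I j)
    linarith
  have hδ : 0 < π / ((n : ℝ) + 1 / 2) := by have := pi_pos; positivity
  have e : node n 0 = π / (n + 1 / 2) * (1 / 2) := by unfold node; push_cast; ring
  rw [e] at hvol
  linarith [mul_le_mul_of_nonneg_left hcard' hδ.le]

/-! ### Degree zero -/

/-- Here `g` is `0` or `1`, so `|h| = sin (x/2) < 1`. Degree zero is treated apart because there the
additive constants in the bounds cannot be absorbed into a multiple of `m`. -/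
lemma Ioo_subset_envelope {A : Finset ℕ} (hA : cosDegree A = 0) :
    Ioo 0 π ⊆ envelope (cosPoly A) := by
  intro x hx
  rw [mem_envelope_iff (Ioo_subset_Ioc_self hx), weighted]
  have hsub : A ⊆ {0} := fun a ha => by
    have : a ≤ cosDegree A := Finset.le_sup (f := id) ha
    simp; omega
  have hs := sin_half_pos hx.1 (by linarith [hx.2, pi_pos])
  have hs1 : sin (x / 2) < 1 := by
    rw [← sin_pi_div_two]
    exact sin_lt_sin_of_lt_of_le_pi_div_two (by linarith [hx.1, pi_pos]) le_rfl
      (by linarith [hx.2])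
  rcases Finset.subset_singleton_iff.1 hsub with rfl | rfl <;> simp only [cosPoly, abs_lt] <;>
    constructor <;> norm_num <;> linarith

lemma volume_envelope_le_pi (g : ℝ → ℝ) : volume.real (envelope g) ≤ π := by
  have := measureReal_mono (μ := volume) (envelope_subset g) measure_Ioc_lt_top.ne
  rwa [Real.volume_real_Ioc_of_le pi_pos.le, sub_zero] at this

lemma pi_le_volume_envelope {A : Finset ℕ} (hA : cosDegree A = 0) :
    π ≤ volume.real (envelope (cosPoly A)) := by
  have := measureReal_mono (μ := volume) (Ioo_subset_envelope hA) (volume_envelope_ne_top _)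
  rwa [Real.volume_real_Ioo_of_le pi_pos.le, sub_zero] at this

/-! ### Assembling the two bounds -/

lemma lower_bound {n : ℕ} {A : Finset ℕ} (hA : cosDegree A ≤ n)
    (hf : (fun x => D n x - cosPoly A x) ≠ 0) :
    (n : ℝ) / (2 * π) * volume.real (envelope (cosPoly A)) - 4 * cosDegree A
      ≤ Z fun x => D n x - cosPoly A x := by
  set V := volume.real (envelope (cosPoly A)) with hV
  have hV0 : 0 ≤ V := measureReal_nonneg
  have hn0 : (0 : ℝ) ≤ n := Nat.cast_nonneg n
  rcases Nat.eq_zero_or_pos (cosDegree A) with h0 | h0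
  · have h1 := card_le_Z hA hf (Finset.range n) (fun j hj => Finset.mem_range.1 hj)
      fun j hj => (Ico_node_subset (Finset.mem_range.1 hj)).trans (Ioo_subset_envelope h0)
    rw [Finset.card_range] at h1
    have h2 : (n : ℝ) / (2 * π) * V ≤ n / (2 * π) * π :=
      mul_le_mul_of_nonneg_left (volume_envelope_le_pi _) (by have := pi_pos; positivity)
    have h3 : (n : ℝ) / (2 * π) * π = n / 2 := by have := pi_pos; field_simp
    have h4 : (n : ℝ) ≤ Z fun x => D n x - cosPoly A x := by exact_mod_cast h1
    rw [h0]
    push_cast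
    linarith
  · have h1 := volume_envelope_le_Z hA hf
    rw [← hV, div_mul_eq_mul_div, le_div_iff₀ (by positivity)] at h1
    -- With `m ≥ 1`, the error `2m + 3/2` is at most `4m`.
    have h2 : (1 : ℝ) ≤ cosDegree A := by exact_mod_cast h0
    have h3 : (n : ℝ) * V / π ≤
        1 / 2 + Z (fun x => D n x - cosPoly A x) + (2 * cosDegree A + 1) := by
      rw [div_le_iff₀ pi_pos]
      linarith
    have h4 : (n : ℝ) / (2 * π) * V = n * V / π / 2 := by have := pi_pos; field_simp
    have h5 : 0 ≤ (n : ℝ) * V / π := by have := pi_pos; positivity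
    rw [h4]
    linarith

/-- Lets additive constants be absorbed into a multiple of `n |𝓔(g)| + m`. -/
lemma one_le_of_pos {n : ℕ} (hn : 1 ≤ n) (A : Finset ℕ) :
    1 ≤ n * volume.real (envelope (cosPoly A)) + cosDegree A := by
  have hn1 : (1 : ℝ) ≤ n := by exact_mod_cast hn
  have hV0 : 0 ≤ volume.real (envelope (cosPoly A)) := measureReal_nonneg
  rcases Nat.eq_zero_or_pos (cosDegree A) with h0 | h0
  · have := pi_le_volume_envelope h0
    have := pi_gt_three
    rw [h0]
    push_cast
    nlinarith
  · have h2 : (1 : ℝ) ≤ cosDegree A := by exact_mod_cast h0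
    have : 0 ≤ n * volume.real (envelope (cosPoly A)) := by positivity
    linarith

/-- For `n < N` only finitely many pairs `(n, A)` occur, since `A ⊆ {0, ..., n}`. -/
lemma exists_ZMult_bound (N : ℕ) :
    ∃ B : ℕ, ∀ n < N, ∀ A : Finset ℕ, cosDegree A ≤ n →
      ZMult (fun x => D n x - cosPoly A x) ≤ B := by
  refine ⟨(Finset.range N ×ˢ (Finset.range (N + 1)).powerset).sup
    fun p => ZMult fun x => D p.1 x - cosPoly p.2 x, fun n hn A hA => ?_⟩
  refine Finset.le_sup (f := fun p : ℕ × Finset ℕ => ZMult fun x => D p.1 x - cosPoly p.2 x)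
    (b := (n, A)) (Finset.mem_product.2 ⟨Finset.mem_range.2 hn, Finset.mem_powerset.2 ?_⟩)
  intro a ha
  have : a ≤ cosDegree A := Finset.le_sup (f := id) ha
  simp; omega

lemma exists_ZMult_le {α : ℝ} (hα : 0 < α) (hα1 : α < 1) :
    ∃ C : ℝ, 0 < C ∧ ∀ (n : ℕ) (A : Finset ℕ), (cosDegree A : ℝ) ≤ (n : ℝ) ^ (1 - α) →
      cosDegree A ≤ n → (fun x => D n x - cosPoly A x) ≠ 0 →
      (ZMult (fun x => D n x - cosPoly A x) : ℝ)
        ≤ C * (n * volume.real (envelope (cosPoly A)) + cosDegree A) := by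
  obtain ⟨K, hK⟩ := exists_nat_gt (1 / α)
  rw [div_lt_iff₀ hα] at hK
  have hK1 : 1 < α * ((K : ℝ) + 1) := by linarith
  have hK2 : 1 < α * (((K + 1 : ℕ) : ℝ) + 1) := by push_cast; linarith
  obtain ⟨n₀, hn₀⟩ := eventually_atTop.1
    ((eventually_pow_lt hα hα1 hK1).and (eventually_pow_lt hα hα1 hK2))
  obtain ⟨B, hB⟩ := exists_ZMult_bound n₀
  -- `8 (K + 1)` serves large `n`: a factor `2` from reflection and a factor `4` from bounding the
  -- cell count by `4 (n V + m)`. `B` serves the small `n`.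
  refine ⟨8 * (K + 1) + B, by positivity, fun n A hm hA hf => ?_⟩
  set V := volume.real (envelope (cosPoly A)) with hV
  have hV0 : 0 ≤ V := measureReal_nonneg
  have hm0 : (0 : ℝ) ≤ cosDegree A := Nat.cast_nonneg _
  have hnV : 0 ≤ (n : ℝ) * V := by positivity
  -- For `n = 0` the right side is `0`, so no zero is allowed: `f ≠ 0` leaves only `g = 0` and `f =
  -- 1`.
  rcases Nat.eq_zero_or_pos n with rfl | hn
  · have hcd : cosDegree A = 0 := by omega
    have h := diff_zero_ne_zero hA hf
    have hsub : A ⊆ {0} := fun a ha => by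
      have : a ≤ cosDegree A := Finset.le_sup (f := id) ha
      simp; omega
    have hempty : zeroSet (fun x => D 0 x - cosPoly A x) = ∅ := by
      rcases Finset.subset_singleton_iff.1 hsub with rfl | rfl
      · simp [zeroSet, D, cosPoly]
      · simp [D, cosPoly] at h
    rw [ZMult, hempty, finsum_mem_empty, hcd]
    simp
  · have hone := one_le_of_pos hn A
    rw [← hV] at hone
    by_cases hlt : n < n₀
    · have h1 : (ZMult (fun x => D n x - cosPoly A x) : ℝ) ≤ B := by
        exact_mod_cast hB n hlt A hA
      have h2 : (0 : ℝ) ≤ B := Nat.cast_nonneg B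
      have h3 : (0 : ℝ) ≤ 8 * (K + 1) := by positivity
      nlinarith
    · obtain ⟨h1, h2⟩ := hn₀ n (not_lt.1 hlt)
      have h := ZMult_le (K := K) hA hf fun k hk => by
        rcases Nat.eq_or_lt_of_le hk.1 with rfl | h'
        · exact h1 _ hm
        · rw [show k = K + 1 by have := hk.2; omega]
          exact h2 _ hm
      have hn1 : (1 : ℝ) ≤ n := by exact_mod_cast hn
      have h3 : (4 * n + 2 : ℝ) / π * V ≤ 2 * (n * V) := by
        rw [div_mul_eq_mul_div, div_le_iff₀ pi_pos]
        have := mul_le_mul_of_nonneg_left pi_gt_three.le hnV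
        nlinarith
      have h4 : (K + 1 : ℝ) * ((4 * n + 2) / π * V + (2 * cosDegree A + 1))
          ≤ (K + 1) * (4 * (n * V + cosDegree A)) :=
        mul_le_mul_of_nonneg_left (by linarith) (by positivity)
      have h5 : 0 ≤ (B : ℝ) * (n * V + cosDegree A) := by positivity
      rw [← hV] at h
      linarith

end CosineZeros

theorem mainTheorem4 :
    ∃ c : ℝ, 0 < c ∧ ∀ α : ℝ, 0 < α → α < 1 →
      ∃ C : ℝ, 0 < C ∧
        ∀ (n : ℕ) (A : Finset ℕ) (m : ℕ) (g f : ℝ → ℝ),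
          g = CosineZeros.cosPoly A →
          m = CosineZeros.cosDegree A →
          (m : ℝ) ≤ (n : ℝ) ^ (1 - α) →
          f = (fun x => CosineZeros.D n x - g x) →
          f ≠ 0 →
          -- there are finitely many zeros, so that both counts below are genuine
          (CosineZeros.zeroSet f).Finite ∧
          -- the two bounds for the number of distinct zeros
          ((n : ℝ) / (2 * Real.pi) * volume.real (CosineZeros.envelope g) - c * m
              ≤ (CosineZeros.Z f : ℝ) ∧
            (CosineZeros.Z f : ℝ)
              ≤ C * (n * volume.real (CosineZeros.envelope g) + m) + c * (n : ℝ) ^ (0.6 : ℝ)) ∧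
          -- the two bounds for the number of zeros counted with multiplicity
          ((n : ℝ) / (2 * Real.pi) * volume.real (CosineZeros.envelope g) - c * m
              ≤ (CosineZeros.ZMult f : ℝ) ∧
            (CosineZeros.ZMult f : ℝ)
              ≤ C * (n * volume.real (CosineZeros.envelope g) + m) + c * (n : ℝ) ^ (0.6 : ℝ)) := by
  refine ⟨4, by norm_num, fun α hα hα1 => ?_⟩
  obtain ⟨C, hC, hbound⟩ := CosineZeros.exists_ZMult_le hα hα1
  refine ⟨C, hC, ?_⟩
  rintro n A m g f rfl rfl hm rfl hf
  have hA : CosineZeros.cosDegree A ≤ n := by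
    rcases Nat.eq_zero_or_pos n with rfl | hn
    · rw [Nat.cast_zero, Real.zero_rpow (by linarith)] at hm
      exact_mod_cast hm
    · have hn1 : (1 : ℝ) ≤ n := by exact_mod_cast hn
      have := Real.rpow_le_rpow_of_exponent_le hn1 (by linarith : 1 - α ≤ 1)
      rw [Real.rpow_one] at this
      exact_mod_cast hm.trans this
  have hle : (CosineZeros.Z (fun x => CosineZeros.D n x - CosineZeros.cosPoly A x) : ℝ)
      ≤ CosineZeros.ZMult fun x => CosineZeros.D n x - CosineZeros.cosPoly A x := by
    exact_mod_cast CosineZeros.Z_le_ZMult hA hf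
  have hlow := CosineZeros.lower_bound hA hf
  have hup := hbound n A hm hA hf
  -- The upper bound already holds without the `n ^ 0.6` term; only its nonnegativity matters.
  have hpow : (0 : ℝ) ≤ 4 * (n : ℝ) ^ (0.6 : ℝ) := by positivity
  exact ⟨CosineZeros.finite_zeroSet hA hf, ⟨hlow, by linarith⟩, by linarith, by linarith⟩
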